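/- An instance of the barrier coverage problem consists of a barrier $[0,L]$ with $L\ge 0$ and $n$ sensors on the real line, with initial locations $x_1\le\dots\le x_n$ and radii $r_i>0$. A solution is a vector $y\in\mathbb R^n$ with $[0,L]\subseteq\bigcup_i B(y_i,r_i)$, where $B(y_i,r_i)=[y_i-r_i,y_i+r_i]$. Its cost is $\mathrm{cost}(y)=\sum_i|y_i-x_i|$, it is optimal if its cost is minimum, and it is $\beta$-approximate if its cost is at most $\beta$ times the optimal cost. Let $\rho=\max_i r_i/\min_i r_i$. A set $S$ of sensors is active for $y$ if $[0,L]\subseteq\bigcup_{i\in S}B(y_i,r_i)$, and minimal active if moreover no proper subset of $S$ is active. A solution is order-preserving if it has an active set $S$ such that $y_i<y_j$ for all $i<j$ in $S$. Untangling. Let $y$ be an optimal solution with a minimal active set $S$. As long as there are $i<j$ in the current minimal active set with $y_i>y_j$ whose intervals overlap (that is, meet), choose such a pair and swap it: the new position of $i$ is $y_j-r_j+r_i$ and the new position of $j$ is $y_i+r_i-r_j$, so that the two intervals together cover the same set as before. Then replace the active set by a subset of it that is minimal active for the new positions; the sensors that are dropped return to their initial locations. An untangling of $y$ (from $S$) is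 a solution $\hat y$ reached in this way by finitely many steps, for which all overlapping active intervals are in order. A $\beta$-balanced cost sharing scheme for $\hat y$ is a function $\xi:S\to\mathbb R_{\ge 0}$ such that $\mathrm{cost}(\hat y)\le\sum_{i\in S}\xi(i)$ and $\xi(i)\le\beta\,|x_i-y_i|$ for all $i\in S$. Lemma. For every optimal solution $y$, every minimal active set $S$ of $y$ and every $\varepsilon>0$ there is an untangling $\hat y$ of $y$ that is an order-preserving solution and admits a $\big((2+\varepsilon)\rho+2/\varepsilon\big)$-balanced cost sharing scheme; consequently, $\hat y$ is $\big((2+\varepsilon)\rho+2/\varepsilon\big)$-approximate. Hence, for every $\delta\ge 0$, every order-preserving solution whose cost is at most $(1+\delta)$ times the cost of every order-preserving solution is $(1+\delta)\big((2+\varepsilon)\rho+2/\varepsilon\big)$-approximate. -/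

import Mathlib

noncomputable section

/-- An instance of the barrier coverage problem with `n` sensors on the real line: sensor `i` has
initial location `x i` and radius `r i`, the sensors are indexed from left to right, and the
barrier is the segment `[0, L]`. -/
structure BarrierInstance (n : ℕ) where
  x : Fin n → ℝ
  r : Fin n → ℝ
  L : ℝ
  r_pos : ∀ i, 0 < r i
  x_mono : Monotone x
  L_nonneg : 0 ≤ L

namespace BarrierInstance

variable {n : ℕ} (I : BarrierInstance n)

/-- The interval covered by sensor `i` when it is located at `y i`. -/
def interval (y : Fin n → ℝ) (i : Fin n) : Set ℝ := Set.Icc (y i - I.r i) (y i + I.r i)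

/-- `S` is active for `y`: the intervals in `S` alone cover the barrier. -/
def IsActive (S : Finset (Fin n)) (y : Fin n → ℝ) : Prop :=
  Set.Icc 0 I.L ⊆ ⋃ i ∈ S, I.interval y i

/-- `S` is active for `y` and no proper subset of `S` is. -/
def IsMinimalActive (S : Finset (Fin n)) (y : Fin n → ℝ) : Prop :=
  Minimal (fun T => I.IsActive T y) S

/-- `y` is a (feasible) solution: the intervals cover the barrier. -/
def IsFeasible (y : Fin n → ℝ) : Prop := I.IsActive Finset.univ y

/-- The total movement. -/
def cost (y : Fin n → ℝ) : ℝ := ∑ i, |y i - I.x i|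

def IsOptimal (y : Fin n → ℝ) : Prop :=
  I.IsFeasible y ∧ ∀ z, I.IsFeasible z → I.cost y ≤ I.cost z

/-- `y` is `β`-approximate: a solution whose cost is at most `β` times the cost of every solution,
that is, at most `β` times the optimal cost. -/
def IsApprox (β : ℝ) (y : Fin n → ℝ) : Prop :=
  I.IsFeasible y ∧ ∀ z, I.IsFeasible z → I.cost y ≤ β * I.cost z

/-- `y` has an active set on which the positions are in the order of the indices. -/
def IsOrderPreserving (y : Fin n → ℝ) : Prop :=
  ∃ S : Finset (Fin n), I.IsActive S y ∧ ∀ i ∈ S, ∀ j ∈ S, i < j → y i < y j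

/-- `y` is an order-preserving solution whose cost is at most `α` times the cost of every
order-preserving solution. -/
def IsApproxOrderPreserving (α : ℝ) (y : Fin n → ℝ) : Prop :=
  I.IsOrderPreserving y ∧ ∀ z, I.IsOrderPreserving z → I.cost y ≤ α * I.cost z

/-- The ratio between the largest and the smallest radius. -/
def rho : ℝ := (⨆ i, I.r i) / (⨅ i, I.r i)

/-- The (closed) intervals of `i` and `j` meet. -/
def Overlap (y : Fin n → ℝ) (i j : Fin n) : Prop :=
  (I.interval y i ∩ I.interval y j).Nonempty

/-- The swap of `i` and `j`, where `i` is to the right of `j` in `y`: afterwards the interval of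
`i` begins where that of `j` began, and the interval of `j` ends where that of `i` ended. For
overlapping intervals neither of which contains the other, as is the case for two members of a
minimal active set, the union of the two intervals does not change. -/
def swap (y : Fin n → ℝ) (i j : Fin n) : Fin n → ℝ :=
  Function.update (Function.update y i (y j - I.r j + I.r i)) j (y i + I.r i - I.r j)

/-- One step of the untangling process. A state consists of a minimal active set and positions.
Two overlapping active intervals that are in the wrong order are swapped; intervals that are no
longer needed are dropped from the active set, and they go back to their initial location. -/
def UntangleStep (s t : Finset (Fin n) × (Fin n → ℝ)) : Prop :=
  ∃ i ∈ s.1, ∃ j ∈ s.1, i < j ∧ s.2 j < s.2 i ∧ I.Overlap s.2 i j ∧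
    t.1 ⊆ s.1 ∧ I.IsMinimalActive t.1 (I.swap s.2 i j) ∧
    t.2 = fun k => if k ∈ t.1 then I.swap s.2 i j k else I.x k

/-- `y'` is a result of untangling `y`, starting with the minimal active set `S`: it is reached
by finitely many steps, and all overlapping active intervals are then in order. -/
def IsUntangling (S : Finset (Fin n)) (y y' : Fin n → ℝ) : Prop :=
  ∃ T : Finset (Fin n), Relation.ReflTransGen I.UntangleStep (S, y) (T, y') ∧
    ∀ i ∈ T, ∀ j ∈ T, i < j → I.Overlap y' i j → y' i < y' j

/-- `ξ` is a `β`-balanced cost sharing scheme for `y'`, with respect to the solution `y` and its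
active set `S`. -/
def IsBalancedScheme (β : ℝ) (S : Finset (Fin n)) (y y' : Fin n → ℝ) (ξ : S → ℝ) : Prop :=
  (∀ i, 0 ≤ ξ i) ∧ I.cost y' ≤ ∑ i, ξ i ∧ ∀ i : S, ξ i ≤ β * |I.x i - y i|

end BarrierInstance

end

/-!
A minimal active set is untangled by swapping overlapping pairs that are in the wrong order. Such a
pair is adjacent, so every swap removes one inversion of the active set and creates none
(`inversions_swap_subset`). Exchanging the two centres alone cannot increase the cost; since the
centres are also shifted by the difference of the radii, a swap costs at most twice that difference
(`cost_swap_le`). Hence the process ends, in an order-preserving solution whose cost exceeds that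
of `y` by at most `∑ 2 * |r i - r j|` over the inversions of `y` (`exists_isUntangling`).

It remains to charge this sum to the movements `D i = |y i - x i|`. If `i < j` are inverted, at
distance `d`, then the movement of `i` to the right and that of `j` to the left add up to at least
`d`, and `d > |r i - r j|` because no interval contains another. Let `m` and `M` be the smallest
and the largest radius. If the two intervals meet, both sensors pay twice their movement, and this
happens to a sensor at most once on each side. Otherwise the larger sensor `a` pays if `D a` is at least about
`d * M / (m + M)`, and else the smaller one `b` has a movement of at least about `d * m / (m + M)`
and pays; the exact threshold (`share`) takes into account that `d > r a + r b`. The sensors for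
which a given one pays lie next to it on one side, within a distance proportional to its movement.
As no three intervals of a minimal active set share a point, the total length of their intervals is
at most twice that of the region which contains them, so a sensor pays at most
`(2 + 2 * (ρ - 1 / ρ)) * D` (`sum_share_le`). The resulting factor `3 + 2 * ρ - 2 / ρ` is at most
`(2 + ε) * ρ + 2 / ε` for every `ε > 0`.

In an optimal solution the sensors outside the active set have not moved, so each active sensor can
bear its own movement times the factor as its share of the cost.
-/

namespace BarrierInstance

/-! ### Packing intervals that cover every point at most twice -/

/-- Intervals inside `[A, B]` no three of which share a point have total length at most
`2 * (B - A)`. -/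
theorem sum_length_le_of_no_three_meet {ι : Type*} (T : Finset ι) (a b : ι → ℝ) (A B : ℝ)
    (hAB : A ≤ B) (hab : ∀ k ∈ T, a k ≤ b k) (hA : ∀ k ∈ T, A ≤ a k) (hB : ∀ k ∈ T, b k ≤ B)
    (h3 : ∀ p : ℝ, ∀ i ∈ T, ∀ j ∈ T, ∀ k ∈ T, p ∈ Set.Icc (a i) (b i) → p ∈ Set.Icc (a j) (b j) →
      p ∈ Set.Icc (a k) (b k) → i = j ∨ i = k ∨ j = k) :
    ∑ k ∈ T, (b k - a k) ≤ 2 * (B - A) := by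
  classical
  have key : ∑ k ∈ T, MeasureTheory.volume (Set.Icc (a k) (b k)) ≤
      2 * MeasureTheory.volume (Set.Icc A B) := by
    calc ∑ k ∈ T, MeasureTheory.volume (Set.Icc (a k) (b k))
        = ∫⁻ p, ∑ k ∈ T, (Set.Icc (a k) (b k)).indicator (fun _ => (1 : ENNReal)) p := by
          rw [MeasureTheory.lintegral_finsetSum]
          · refine Finset.sum_congr rfl fun k _ => ?_
            rw [MeasureTheory.lintegral_indicator measurableSet_Icc]
            simp
          · intro k _
            exact measurable_const.indicator measurableSet_Icc
      _ ≤ ∫⁻ p, (Set.Icc A B).indicator (fun _ => (2 : ENNReal)) p := by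
          refine MeasureTheory.lintegral_mono fun p => ?_
          have h1 : ∑ k ∈ T, (Set.Icc (a k) (b k)).indicator (fun _ => (1 : ENNReal)) p
              = ((T.filter fun k => p ∈ Set.Icc (a k) (b k)).card : ENNReal) := by
            rw [Finset.card_filter]
            push_cast
            refine Finset.sum_congr rfl fun k _ => ?_
            simp [Set.indicator_apply]
          have h2 : (T.filter fun k => p ∈ Set.Icc (a k) (b k)).card ≤ 2 := by
            by_contra hc
            obtain ⟨i, j, k, hi, hj, hk, hij, hik, hjk⟩ :=
              Finset.two_lt_card_iff.1 (not_le.1 hc)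
            simp only [Finset.mem_filter] at hi hj hk
            rcases h3 p i hi.1 j hj.1 k hk.1 hi.2 hj.2 hk.2 with h | h | h <;> contradiction
          beta_reduce
          rw [h1]
          by_cases hp : p ∈ Set.Icc A B
          · rw [Set.indicator_of_mem hp]
            exact_mod_cast h2
          · have : (T.filter fun k => p ∈ Set.Icc (a k) (b k)) = ∅ := by
              refine Finset.filter_eq_empty_iff.2 fun k hk hpk => hp ?_
              exact ⟨(hA k hk).trans hpk.1, hpk.2.trans (hB k hk)⟩
            rw [this]
            simp
      _ = 2 * MeasureTheory.volume (Set.Icc A B) := by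
          rw [MeasureTheory.lintegral_indicator measurableSet_Icc]
          simp
  simp only [Real.volume_Icc] at key
  rw [← ENNReal.ofReal_sum_of_nonneg (fun k hk => sub_nonneg.2 (hab k hk)),
    show (2 : ENNReal) = ENNReal.ofReal 2 by simp,
    ← ENNReal.ofReal_mul (by norm_num)] at key
  exact (ENNReal.ofReal_le_ofReal_iff (by linarith)).1 key

/-- Intervals with centres `y` and radii `r` such that no three of them share a point and none
contains another. This is what remains of the minimality of an active set in the charging
argument; unlike minimality, it does not refer to the barrier and is symmetric under reflection. -/
structure ThinFamily {ι : Type*} (S : Finset ι) (y r : ι → ℝ) : Prop where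
  no_three_meet : ∀ p : ℝ, ∀ i ∈ S, ∀ j ∈ S, ∀ k ∈ S, |p - y i| ≤ r i → |p - y j| ≤ r j →
    |p - y k| ≤ r k → i = j ∨ i = k ∨ j = k
  abs_sub_lt : ∀ i ∈ S, ∀ j ∈ S, i ≠ j → |r i - r j| < |y i - y j|

theorem ThinFamily.neg {ι : Type*} {S : Finset ι} {y r : ι → ℝ} (h : ThinFamily S y r) :
    ThinFamily S (fun i => -y i) r where
  no_three_meet p i hi j hj k hk h1 h2 h3 := by
    have e : ∀ l, |-p - y l| = |p - -y l| := fun l => by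
      rw [← abs_neg]; congr 1; ring
    exact h.no_three_meet (-p) i hi j hj k hk (by rwa [e]) (by rwa [e]) (by rwa [e])
  abs_sub_lt i hi j hj hij := by
    have : |-y i - -y j| = |y i - y j| := by
      rw [← abs_neg]; congr 1; ring
    rw [this]
    exact h.abs_sub_lt i hi j hj hij

/-! ### Charging inverted pairs to the movements -/

/-- What a sensor of radius `R` that moved by `D` pays for an inversion with a sensor of radius `q`
at distance `d`, when all radii lie in `[m, M]`. If the intervals meet, it pays `2 * D`. Otherwise
the larger of the two sensors pays twice the difference of the radii if its movement is large
enough for that, and if not the smaller one does. -/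
noncomputable def share (m M D R q d : ℝ) : ℝ :=
  if d ≤ R + q then 2 * D
  else if q ≤ R then (if d ≤ D * (1 + m / M) + R - m then 2 * (R - q) else 0)
  else (if d ≤ D * (1 + M / m) - M / m * (q - m) then 2 * (q - R) else 0)

theorem share_nonneg {m M D R q d : ℝ} (hD : 0 ≤ D) : 0 ≤ share m M D R q d := by
  unfold share
  split_ifs <;> linarith

/-- If the movements of two sensors add up to at least their distance, the two shares pay for
twice the difference of the radii. -/
theorem two_mul_abs_sub_le_share_add_share {m M D E R q d : ℝ} (hm : 0 < m) (hM : 0 < M)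
    (hD : 0 ≤ D) (hE : 0 ≤ E) (hd : d ≤ D + E) (hRq : |R - q| < d) :
    2 * |R - q| ≤ share m M D R q d + share m M E q R d := by
  wlog h : q ≤ R generalizing D E R q
  · have := this hE hD (by linarith) (by rwa [abs_sub_comm]) (le_of_not_ge h)
    rw [abs_sub_comm]
    linarith
  rw [abs_of_nonneg (by linarith)] at hRq ⊢
  by_cases hov : d ≤ R + q
  · have h1 : share m M D R q d = 2 * D := by simp [share, hov]
    have h2 : share m M E q R d = 2 * E := by
      have : d ≤ q + R := by linarith
      simp [share, this]
    linarith
  by_cases hpay : d ≤ D * (1 + m / M) + R - m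
  · have h1 : share m M D R q d = 2 * (R - q) := by simp [share, hov, h, hpay]
    have := share_nonneg (m := m) (M := M) (R := q) (q := R) (d := d) hE
    linarith
  rcases h.eq_or_lt with heq | hlt
  · have := share_nonneg (m := m) (M := M) (R := q) (q := R) (d := d) hE
    have := share_nonneg (m := m) (M := M) (R := R) (q := q) (d := d) hD
    linarith
  · have hpay' : d ≤ E * (1 + M / m) - M / m * (R - m) := by
      have h1 : D * (M + m) / M + R - m < d := by
        have : D * (M + m) / M = D * (1 + m / M) := by field_simp
        linarith
      have h2 : D * (M + m) + (R - m) * M < d * M := by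
        have : D * (M + m) + (R - m) * M = (D * (M + m) / M + R - m) * M := by
          field_simp
          ring
        rw [this]
        exact mul_lt_mul_of_pos_right h1 hM
      have h3 : d * (M + m) ≤ (D + E) * (M + m) :=
        mul_le_mul_of_nonneg_right hd (by linarith)
      have h4 : d ≤ (E * (M + m) - M * (R - m)) / m := by
        rw [le_div_iff₀ hm]
        linarith
      have : (E * (M + m) - M * (R - m)) / m = E * (1 + M / m) - M / m * (R - m) := by
        field_simp
        ring
      linarith
    have hov' : ¬ d ≤ q + R := by linarith
    have h2 : share m M E q R d = 2 * (R - q) := by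
      simp [share, hov', not_le.2 hlt, hpay']
    have := share_nonneg (m := m) (M := M) (R := R) (q := q) (d := d) hD
    linarith

/-- The total that a sensor `s` pays for sensors to its left is at most a constant times its
movement `D`: at most one of their intervals meets that of `s`, and those for which `s` pays
otherwise have to be packed next to the interval of `s`, with every point covered at most twice. -/
theorem sum_share_le {ι : Type*} {S : Finset ι} {y r : ι → ℝ} (h : ThinFamily S y r)
    {m M D : ℝ} (hm : 0 < m) (hr : ∀ i, m ≤ r i ∧ r i ≤ M) (hD : 0 ≤ D) {s : ι} (hs : s ∈ S)
    (T : Finset ι) (hTS : T ⊆ S) (hT : ∀ k ∈ T, y k < y s) :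
    ∑ k ∈ T, share m M D (r s) (r k) |y s - y k| ≤ (2 + 2 * (M / m - m / M)) * D := by
  classical
  have hmM : m ≤ M := (hr s).1.trans (hr s).2
  have hM : 0 < M := hm.trans_le hmM
  have habs : ∀ k ∈ T, |y s - y k| = y s - y k := fun k hk =>
    abs_of_pos (by linarith [hT k hk])
  -- the sensors that meet `s`, the smaller ones and the larger ones for which `s` pays
  set A := T.filter fun k => y s - y k ≤ r s + r k with hA
  set B := T.filter fun k => ¬ y s - y k ≤ r s + r k ∧ r k ≤ r s ∧
    y s - y k ≤ D * (1 + m / M) + r s - m with hB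
  set C := T.filter fun k => ¬ y s - y k ≤ r s + r k ∧ ¬ r k ≤ r s ∧
    y s - y k ≤ D * (1 + M / m) - M / m * (r k - m) with hC
  have split : ∑ k ∈ T, share m M D (r s) (r k) |y s - y k| =
      ∑ k ∈ A, 2 * D + ∑ k ∈ B, 2 * (r s - r k) + ∑ k ∈ C, 2 * (r k - r s) := by
    rw [hA, hB, hC, Finset.sum_filter, Finset.sum_filter, Finset.sum_filter,
      ← Finset.sum_add_distrib, ← Finset.sum_add_distrib]
    refine Finset.sum_congr rfl fun k hk => ?_
    rw [habs k hk]
    unfold share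
    by_cases h1 : y s - y k ≤ r s + r k
    · simp [h1]
    · by_cases h2 : r k ≤ r s
      · simp [h1, h2]
      · simp [h1, h2]
  have hA1 : ∑ k ∈ A, 2 * D ≤ 2 * D := by
    have : A.card ≤ 1 := by
      refine Finset.card_le_one.2 fun i hi j hj => ?_
      simp only [hA, Finset.mem_filter] at hi hj
      -- both intervals contain the left endpoint of the interval of `s`
      have hmem : ∀ k ∈ T, y s - y k ≤ r s + r k → |y s - r s - y k| ≤ r k := by
        intro k hk hk'
        have hlt := hT k hk
        have h1 := h.abs_sub_lt s hs k (hTS hk) (by rintro rfl; exact lt_irrefl _ hlt)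
        rw [habs k hk, abs_lt] at h1
        have := hr k
        rw [abs_le]
        constructor <;> linarith
      have hss : |y s - r s - y s| ≤ r s := by
        have := hr s
        rw [show y s - r s - y s = -r s by ring, abs_neg, abs_of_nonneg (by linarith)]
      rcases h.no_three_meet (y s - r s) i (hTS hi.1) j (hTS hj.1) s hs (hmem i hi.1 hi.2)
        (hmem j hj.1 hj.2) hss with e | e | e
      · exact e
      · exact absurd (hT i hi.1) (by rw [e]; exact lt_irrefl _)
      · exact absurd (hT j hj.1) (by rw [e]; exact lt_irrefl _)
    rw [Finset.sum_const, nsmul_eq_mul]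
    have h1 : (A.card : ℝ) ≤ 1 := by exact_mod_cast this
    nlinarith
  -- the intervals of radius `m` around the sensors in `B` are packed
  have hB1 : (B.card : ℝ) * m ≤ D * (1 + m / M) := by
    have := sum_length_le_of_no_three_meet B (fun k => y k - m) (fun k => y k + m)
      (y s - r s - D * (1 + m / M)) (y s - r s)
      (by have : 0 ≤ D * (1 + m / M) := by positivity
          linarith)
      (fun k _ => by linarith)
      (fun k hk => by
        simp only [hB, Finset.mem_filter] at hk
        linarith [hk.2.2.2])
      (fun k hk => by
        simp only [hB, Finset.mem_filter, not_le] at hk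
        linarith [hk.2.1, (hr k).1])
      (fun p i hi j hj k hk h1 h2 h3 => by
        have hmem : ∀ l, p ∈ Set.Icc (y l - m) (y l + m) → |p - y l| ≤ r l := fun l hl => by
          have := hr l
          rw [abs_le]
          constructor <;> linarith [hl.1, hl.2]
        exact h.no_three_meet p i (hTS (Finset.mem_filter.1 hi).1) j
          (hTS (Finset.mem_filter.1 hj).1) k (hTS (Finset.mem_filter.1 hk).1)
          (hmem i h1) (hmem j h2) (hmem k h3))
    have e : ∑ k ∈ B, ((y k + m) - (y k - m)) = 2 * (B.card * m) := by
      rw [Finset.sum_congr rfl (fun k _ => show (y k + m) - (y k - m) = 2 * m by ring),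
        Finset.sum_const, nsmul_eq_mul]
      ring
    rw [e] at this
    linarith
  have hC1 : ∑ k ∈ C, r k ≤ D * (1 + M / m) := by
    have hMm : 1 ≤ M / m := (one_le_div hm).2 hmM
    have := sum_length_le_of_no_three_meet C (fun k => y k - r k) (fun k => y k + r k)
      (y s - r s - D * (1 + M / m)) (y s - r s)
      (by have : 0 ≤ D * (1 + M / m) := by positivity
          linarith)
      (fun k _ => by linarith [hr k])
      (fun k hk => by
        simp only [hC, Finset.mem_filter] at hk
        have h1 : r k - m ≤ M / m * (r k - m) :=
          le_mul_of_one_le_left (by linarith [hr k]) hMm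
        linarith [hk.2.2.2, hr s])
      (fun k hk => by
        simp only [hC, Finset.mem_filter, not_le] at hk
        linarith [hk.2.1])
      (fun p i hi j hj k hk h1 h2 h3 => by
        have hmem : ∀ l, p ∈ Set.Icc (y l - r l) (y l + r l) → |p - y l| ≤ r l := fun l hl => by
          rw [abs_le]
          constructor <;> linarith [hl.1, hl.2]
        exact h.no_three_meet p i (hTS (Finset.mem_filter.1 hi).1) j
          (hTS (Finset.mem_filter.1 hj).1) k (hTS (Finset.mem_filter.1 hk).1)
          (hmem i h1) (hmem j h2) (hmem k h3))
    have e : ∑ k ∈ C, ((y k + r k) - (y k - r k)) = 2 * ∑ k ∈ C, r k := by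
      rw [Finset.mul_sum]
      exact Finset.sum_congr rfl fun k _ => by ring
    rw [e] at this
    linarith
  have hB2 : ∑ k ∈ B, 2 * (r s - r k) ≤ 2 * (r s - m) * (D * (1 + m / M) / m) := by
    calc ∑ k ∈ B, 2 * (r s - r k) ≤ ∑ k ∈ B, 2 * (r s - m) :=
          Finset.sum_le_sum fun k _ => by linarith [(hr k).1]
      _ = 2 * (r s - m) * B.card := by rw [Finset.sum_const, nsmul_eq_mul]; ring
      _ ≤ _ := by
          refine mul_le_mul_of_nonneg_left ?_ (by linarith [(hr s).1])
          rwa [le_div_iff₀ hm]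
  have hC2 : ∑ k ∈ C, 2 * (r k - r s) ≤ 2 * (1 - r s / M) * (D * (1 + M / m)) := by
    have h1 : r s / M ≤ 1 := (div_le_one hM).2 (hr s).2
    calc ∑ k ∈ C, 2 * (r k - r s) ≤ ∑ k ∈ C, 2 * (1 - r s / M) * r k := by
          refine Finset.sum_le_sum fun k _ => ?_
          have h2 : r s / M * r k ≤ r s := by
            rw [div_mul_eq_mul_div, div_le_iff₀ hM]
            exact mul_le_mul_of_nonneg_left (hr k).2 (by linarith [(hr s).1])
          linarith
      _ = 2 * (1 - r s / M) * ∑ k ∈ C, r k := by rw [Finset.mul_sum]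
      _ ≤ _ := mul_le_mul_of_nonneg_left hC1 (by linarith)
  have e : 2 * (r s - m) * (D * (1 + m / M) / m) + 2 * (1 - r s / M) * (D * (1 + M / m)) =
      2 * (M / m - m / M) * D := by
    field_simp
    ring
  rw [split]
  linarith

/-- The pairs of active sensors whose positions are in the wrong order. -/
noncomputable def inversions {n : ℕ} (S : Finset (Fin n)) (y : Fin n → ℝ) : Finset (Fin n × Fin n) :=
  (S ×ˢ S).filter fun q => q.1 < q.2 ∧ y q.2 < y q.1

theorem mem_inversions {n : ℕ} {S : Finset (Fin n)} {y : Fin n → ℝ} {q : Fin n × Fin n} :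
    q ∈ inversions S y ↔ (q.1 ∈ S ∧ q.2 ∈ S) ∧ q.1 < q.2 ∧ y q.2 < y q.1 := by
  simp [inversions]

/-- The radius differences over all inversions are paid for by the movements. Sensor `i` pays only
for sensors on the side from which it came, so every sensor pays on one side only. -/
theorem sum_inversions_le {n : ℕ} {S : Finset (Fin n)} {x y r : Fin n → ℝ} (hx : Monotone x)
    (h : ThinFamily S y r) {m M : ℝ} (hm : 0 < m) (hr : ∀ i, m ≤ r i ∧ r i ≤ M) :
    ∑ q ∈ inversions S y, 2 * |r q.1 - r q.2| ≤
      (2 + 2 * (M / m - m / M)) * ∑ i ∈ S, |y i - x i| := by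
  classical
  set f : Fin n → ℝ := fun i => max (y i - x i) 0
  set g : Fin n → ℝ := fun i => max (x i - y i) 0
  have hf : ∀ i, 0 ≤ f i := fun i => le_max_right _ _
  have hg : ∀ i, 0 ≤ g i := fun i => le_max_right _ _
  have hfg : ∀ i, f i + g i = |y i - x i| := fun i => by
    rcases le_total (x i) (y i) with h | h
    · simp only [f, g]
      rw [max_eq_left (by linarith), max_eq_right (by linarith), abs_of_nonneg (by linarith)]
      ring
    · simp only [f, g]
      rw [max_eq_right (by linarith), max_eq_left (by linarith), abs_of_nonpos (by linarith)]
      ring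
  have h1 : ∀ i ∈ S, ∑ j ∈ S, (if y j < y i then share m M (f i) (r i) (r j) |y i - y j| else 0)
      ≤ (2 + 2 * (M / m - m / M)) * f i := fun i hi => by
    rw [← Finset.sum_filter]
    exact sum_share_le h hm hr (hf i) hi _ (Finset.filter_subset _ _)
      fun k hk => (Finset.mem_filter.1 hk).2
  have h2 : ∀ j ∈ S, ∑ i ∈ S, (if y j < y i then share m M (g j) (r j) (r i) |y i - y j| else 0)
      ≤ (2 + 2 * (M / m - m / M)) * g j := fun j hj => by
    rw [← Finset.sum_filter]
    have := sum_share_le h.neg hm hr (hg j) hj (S.filter fun i => y j < y i)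
      (Finset.filter_subset _ _) fun k hk => neg_lt_neg (Finset.mem_filter.1 hk).2
    refine le_of_eq_of_le (Finset.sum_congr rfl fun i _ => ?_) this
    congr 2
    ring
  calc ∑ q ∈ inversions S y, 2 * |r q.1 - r q.2|
      ≤ ∑ q ∈ inversions S y, (share m M (f q.1) (r q.1) (r q.2) |y q.1 - y q.2| +
          share m M (g q.2) (r q.2) (r q.1) |y q.1 - y q.2|) := by
        refine Finset.sum_le_sum fun q hq => ?_
        obtain ⟨⟨hq1, hq2⟩, hlt, hy⟩ := mem_inversions.1 hq
        have hM : 0 < M := hm.trans_le ((hr q.1).1.trans (hr q.1).2)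
        refine two_mul_abs_sub_le_share_add_share hm hM (hf _) (hg _) ?_
          (h.abs_sub_lt _ hq1 _ hq2 hlt.ne)
        rw [abs_of_pos (by linarith)]
        have h3 := hx hlt.le
        have h4 : y q.1 - x q.1 ≤ f q.1 := le_max_left _ _
        have h5 : x q.2 - y q.2 ≤ g q.2 := le_max_left _ _
        linarith
    _ ≤ ∑ q ∈ S ×ˢ S, (if y q.2 < y q.1 then
          share m M (f q.1) (r q.1) (r q.2) |y q.1 - y q.2| +
          share m M (g q.2) (r q.2) (r q.1) |y q.1 - y q.2| else 0) := by
        rw [inversions, Finset.sum_filter]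
        refine Finset.sum_le_sum fun q _ => ?_
        have := share_nonneg (m := m) (M := M) (R := r q.1) (q := r q.2) (d := |y q.1 - y q.2|)
          (hf q.1)
        have := share_nonneg (m := m) (M := M) (R := r q.2) (q := r q.1) (d := |y q.1 - y q.2|)
          (hg q.2)
        by_cases hlt : y q.2 < y q.1 <;> by_cases hq : q.1 < q.2 <;> simp [hlt, hq]
        linarith
    _ = ∑ i ∈ S, ∑ j ∈ S, (if y j < y i then share m M (f i) (r i) (r j) |y i - y j| else 0) +
        ∑ j ∈ S, ∑ i ∈ S, (if y j < y i then share m M (g j) (r j) (r i) |y i - y j| else 0) := by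
        rw [Finset.sum_comm (s := S) (t := S) (f := fun j i =>
          if y j < y i then share m M (g j) (r j) (r i) |y i - y j| else 0),
          ← Finset.sum_add_distrib, Finset.sum_product]
        refine Finset.sum_congr rfl fun i _ => ?_
        rw [← Finset.sum_add_distrib]
        refine Finset.sum_congr rfl fun j _ => ?_
        by_cases hlt : y j < y i <;> simp [hlt]
    _ ≤ ∑ i ∈ S, (2 + 2 * (M / m - m / M)) * f i + ∑ i ∈ S, (2 + 2 * (M / m - m / M)) * g i :=
        add_le_add (Finset.sum_le_sum h1) (Finset.sum_le_sum h2)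
    _ = (2 + 2 * (M / m - m / M)) * ∑ i ∈ S, |y i - x i| := by
        rw [← Finset.sum_add_distrib, Finset.mul_sum]
        refine Finset.sum_congr rfl fun i _ => ?_
        rw [← hfg i]
        ring

/-! ### Minimal active sets -/

section MinimalActive

variable {n : ℕ} {I : BarrierInstance n} {S T : Finset (Fin n)} {y z : Fin n → ℝ} {i j : Fin n}

theorem isActive_iff : I.IsActive S y ↔
    ∀ p, 0 ≤ p → p ≤ I.L → ∃ k ∈ S, y k - I.r k ≤ p ∧ p ≤ y k + I.r k := by
  simp only [IsActive, interval, Set.subset_def, Set.mem_iUnion, Set.mem_Icc, exists_prop, and_imp]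

theorem IsActive.congr (h : I.IsActive S y) (hyz : ∀ k ∈ S, y k = z k) : I.IsActive S z := by
  rw [isActive_iff] at h ⊢
  intro p hp hpL
  obtain ⟨k, hk, hk'⟩ := h p hp hpL
  exact ⟨k, hk, by rwa [← hyz k hk]⟩

theorem IsActive.mono (h : I.IsActive S y) (hST : S ⊆ T) : I.IsActive T y := by
  rw [isActive_iff] at h ⊢
  intro p hp hpL
  obtain ⟨k, hk, hk'⟩ := h p hp hpL
  exact ⟨k, hST hk, hk'⟩

theorem IsMinimalActive.congr (h : I.IsMinimalActive S y) (hyz : ∀ k ∈ S, y k = z k) :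
    I.IsMinimalActive S z :=
  ⟨IsActive.congr h.1 hyz, fun _ hT hTS =>
    h.2 (IsActive.congr hT fun k hk => (hyz k (hTS hk)).symm) hTS⟩

theorem IsActive.exists_isMinimalActive (h : I.IsActive S y) :
    ∃ T ⊆ S, I.IsMinimalActive T y :=
  exists_minimal_le_of_wellFoundedLT (fun T => I.IsActive T y) S h

/-- Every sensor of a minimal active set covers a point of the barrier that no other one covers. -/
theorem IsMinimalActive.exists_private_point (h : I.IsMinimalActive S y) (hi : i ∈ S) :
    ∃ p, 0 ≤ p ∧ p ≤ I.L ∧ y i - I.r i ≤ p ∧ p ≤ y i + I.r i ∧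
      ∀ k ∈ S, y k - I.r k ≤ p → p ≤ y k + I.r k → k = i := by
  have h1 : ¬ I.IsActive (S.erase i) y := fun hc =>
    Finset.notMem_erase i S (h.2 hc (Finset.erase_subset i S) hi)
  rw [isActive_iff] at h1
  push Not at h1
  obtain ⟨p, hp, hpL, hpk⟩ := h1
  have hpriv : ∀ k ∈ S, y k - I.r k ≤ p → p ≤ y k + I.r k → k = i := by
    intro k hk h2 h3
    by_contra hne
    exact absurd h3 (not_le.2 (hpk k (Finset.mem_erase.2 ⟨hne, hk⟩) h2))
  obtain ⟨k, hk, h2, h3⟩ := isActive_iff.1 h.1 p hp hpL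
  obtain rfl := hpriv k hk h2 h3
  exact ⟨p, hp, hpL, h2, h3, hpriv⟩

/-- If three intervals shared a point, the private points of two of them would lie on the same
side of it, and the interval with the farther one would contain the nearer one. -/
theorem IsMinimalActive.thinFamily (h : I.IsMinimalActive S y) : ThinFamily S y I.r where
  no_three_meet c i hi j hj k hk h1 h2 h3 := by
    have pair : ∀ a ∈ S, ∀ b ∈ S, |c - y a| ≤ I.r a → |c - y b| ≤ I.r b → ∀ p q,
        y a - I.r a ≤ p → p ≤ y a + I.r a → y b - I.r b ≤ q → q ≤ y b + I.r b →
        (∀ l ∈ S, y l - I.r l ≤ p → p ≤ y l + I.r l → l = a) →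
        (∀ l ∈ S, y l - I.r l ≤ q → q ≤ y l + I.r l → l = b) →
        (p ≤ c ∧ q ≤ c ∨ c ≤ p ∧ c ≤ q) → a = b := by
      intro a ha b hb hca hcb p q hp1 hp2 hq1 hq2 hp hq hside
      rw [abs_le] at hca hcb
      rcases le_total p q with hpq | hpq <;> rcases hside with hs | hs
      · exact hq a ha (by linarith) (by linarith)
      · exact (hp b hb (by linarith) (by linarith)).symm
      · exact (hp b hb (by linarith) (by linarith)).symm
      · exact hq a ha (by linarith) (by linarith)
    obtain ⟨p, -, -, hp1, hp2, hp⟩ := h.exists_private_point hi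
    obtain ⟨q, -, -, hq1, hq2, hq⟩ := h.exists_private_point hj
    obtain ⟨s, -, -, hs1, hs2, hs⟩ := h.exists_private_point hk
    have hij := pair i hi j hj h1 h2 p q hp1 hp2 hq1 hq2 hp hq
    have hik := pair i hi k hk h1 h3 p s hp1 hp2 hs1 hs2 hp hs
    have hjk := pair j hj k hk h2 h3 q s hq1 hq2 hs1 hs2 hq hs
    have := le_total p c
    have := le_total q c
    have := le_total s c
    tauto
  abs_sub_lt i hi j hj hij := by
    by_contra hc
    rw [not_lt] at hc
    obtain ⟨p, -, -, hp1, hp2, hp⟩ := h.exists_private_point hi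
    obtain ⟨q, -, -, hq1, hq2, hq⟩ := h.exists_private_point hj
    have h1 := abs_le.1 hc
    rcases le_total (I.r i) (I.r j) with hr | hr
    · rw [abs_of_nonpos (by linarith)] at h1
      exact hij (hp j hj (by linarith) (by linarith)).symm
    · rw [abs_of_nonneg (by linarith)] at h1
      exact hij (hq i hi (by linarith) (by linarith))

theorem overlap_iff : I.Overlap y i j ↔
    y j - I.r j ≤ y i + I.r i ∧ y i - I.r i ≤ y j + I.r j := by
  have hi := I.r_pos i
  have hj := I.r_pos j
  constructor
  · rintro ⟨p, ⟨h1, h2⟩, h3, h4⟩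
    constructor <;> linarith
  · rintro ⟨h1, h2⟩
    refine ⟨max (y i - I.r i) (y j - I.r j), ⟨le_max_left _ _, ?_⟩, le_max_right _ _, ?_⟩
    · exact max_le (by linarith) h1
    · exact max_le h2 (by linarith)

/-- If all overlapping intervals of a minimal active set are in order, then all intervals are: for
an inversion at the smallest distance, no centre lies between the two centres, so that a gap
between the two intervals would not be covered. -/
theorem IsMinimalActive.lt_of_overlap_ordered (h : I.IsMinimalActive S y)
    (hov : ∀ i ∈ S, ∀ j ∈ S, i < j → I.Overlap y i j → y i < y j) :
    ∀ i ∈ S, ∀ j ∈ S, i < j → y i < y j := by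
  intro i₀ hi₀ j₀ hj₀ hij₀
  by_contra hc
  have hthin := h.thinFamily
  have hne : ∀ a ∈ S, ∀ b ∈ S, a ≠ b → y a ≠ y b := fun a ha b hb hab he => by
    have := hthin.abs_sub_lt a ha b hb hab
    rw [he, sub_self, abs_zero] at this
    exact absurd this (not_lt.2 (abs_nonneg _))
  have hnon : (inversions S y).Nonempty := ⟨(i₀, j₀), mem_inversions.2 ⟨⟨hi₀, hj₀⟩, hij₀,
    lt_of_le_of_ne (not_lt.1 hc) (hne j₀ hj₀ i₀ hi₀ hij₀.ne')⟩⟩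
  obtain ⟨⟨i, j⟩, hmem, hmin⟩ := (inversions S y).exists_min_image (fun q => y q.1 - y q.2) hnon
  obtain ⟨⟨hi, hj⟩, hij, hlt⟩ := mem_inversions.1 hmem
  dsimp only at hi hj hij hlt hmin
  have hbetween : ∀ k ∈ S, y j < y k → y k < y i → False := by
    intro k hk hjk hki
    rcases lt_or_ge k j with hkj | hkj
    · have := hmin (k, j) (mem_inversions.2 ⟨⟨hk, hj⟩, hkj, hjk⟩)
      dsimp only at this
      linarith
    · have := hmin (i, k) (mem_inversions.2 ⟨⟨hi, hk⟩, hij.trans_le hkj, hki⟩)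
      dsimp only at this
      linarith
  have hno : ¬ I.Overlap y i j := fun ho => lt_asymm hlt (hov i hi j hj hij ho)
  have hri := I.r_pos i
  have hrj := I.r_pos j
  have hgap : y j + I.r j < y i - I.r i := by
    by_contra hc'
    exact hno (overlap_iff.2 ⟨by linarith, by linarith⟩)
  obtain ⟨p, -, hpL, hp1, hp2, -⟩ := h.exists_private_point hi
  obtain ⟨q, hq0, -, hq1, hq2, -⟩ := h.exists_private_point hj
  -- the private points show that the gap lies inside the barrier
  obtain ⟨c, hc1, hc2⟩ := exists_between hgap
  obtain ⟨k, hk, hk1, hk2⟩ := isActive_iff.1 h.1 c (by linarith) (by linarith)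
  have hkj : k ≠ j := by rintro rfl; linarith
  have hki : k ≠ i := by rintro rfl; linarith
  have h1 := hthin.abs_sub_lt k hk j hj hkj
  have h2 := hthin.abs_sub_lt k hk i hi hki
  refine hbetween k hk ?_ ?_
  · by_contra hcon
    rw [abs_of_nonpos (show y k - y j ≤ 0 by linarith)] at h1
    have := (abs_lt.1 h1).2
    linarith
  · by_contra hcon
    rw [abs_of_nonneg (show 0 ≤ y k - y i by linarith)] at h2
    have := (abs_lt.1 h2).2
    linarith

/-! ### One swap -/

theorem swap_apply_left (hij : i ≠ j) : I.swap y i j i = y j - I.r j + I.r i := by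
  simp [swap, hij]

theorem swap_apply_right : I.swap y i j j = y i + I.r i - I.r j := by
  simp [swap]

theorem swap_apply_of_ne {k : Fin n} (hi : k ≠ i) (hj : k ≠ j) : I.swap y i j k = y k := by
  simp [swap, hi, hj]

theorem IsMinimalActive.isActive_swap (h : I.IsMinimalActive S y) (hi : i ∈ S) (hj : j ∈ S)
    (hlt : y j < y i) (hov : I.Overlap y i j) : I.IsActive S (I.swap y i j) := by
  have hij : i ≠ j := by rintro rfl; exact lt_irrefl _ hlt
  have hthin := h.thinFamily.abs_sub_lt i hi j hj hij
  rw [abs_of_pos (by linarith : 0 < y i - y j), abs_lt] at hthin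
  have ho := overlap_iff.1 hov
  rw [isActive_iff]
  intro p hp hpL
  obtain ⟨k, hk, hk1, hk2⟩ := isActive_iff.1 h.1 p hp hpL
  by_cases hkij : k = i ∨ k = j
  · have hp1 : y j - I.r j ≤ p := by rcases hkij with rfl | rfl <;> linarith
    have hp2 : p ≤ y i + I.r i := by rcases hkij with rfl | rfl <;> linarith
    rcases le_total p (y j - I.r j + 2 * I.r i) with hpi | hpi
    · refine ⟨i, hi, ?_, ?_⟩ <;> rw [swap_apply_left hij] <;> linarith
    · refine ⟨j, hj, ?_, ?_⟩ <;> rw [swap_apply_right] <;> linarith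
  · rw [not_or] at hkij
    exact ⟨k, hk, by rwa [swap_apply_of_ne hkij.1 hkij.2], by rwa [swap_apply_of_ne hkij.1 hkij.2]⟩

/-- A swap removes the swapped inversion and creates no new one within a minimal active set. -/
theorem inversions_swap_subset (hS : I.IsMinimalActive S y) (hi : i ∈ S) (hj : j ∈ S)
    (hidx : i < j) (hlt : y j < y i) (hov : I.Overlap y i j) (hTS : T ⊆ S)
    (hT : I.IsMinimalActive T (I.swap y i j)) :
    inversions T (I.swap y i j) ⊆ (inversions S y).erase (i, j) := by
  have hij : i ≠ j := hidx.ne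
  have hthin := hS.thinFamily
  have hthinT := hT.thinFamily
  have ho := overlap_iff.1 hov
  have hri := I.r_pos i
  have hrj := I.r_pos j
  have hswap : I.swap y i j i < I.swap y i j j := by
    rw [swap_apply_left hij, swap_apply_right]
    linarith
  have hdij := hthin.abs_sub_lt i hi j hj hij
  rw [abs_of_pos (by linarith : 0 < y i - y j), abs_lt] at hdij
  -- the other sensors stay on the same side of `i` and `j`
  have hside : ∀ k ∈ T, k ≠ i → k ≠ j → ∀ a ∈ T, (a = i ∨ a = j) →
      (y k < y j ∧ I.swap y i j k < I.swap y i j a) ∨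
      (y i < y k ∧ I.swap y i j a < I.swap y i j k) := by
    intro k hk hki hkj a ha hai
    have hka : k ≠ a := by rcases hai with rfl | rfl <;> assumption
    have hdT := hthinT.abs_sub_lt k hk a ha hka
    have hdi := hthin.abs_sub_lt k (hTS hk) i hi hki
    have hdj := hthin.abs_sub_lt k (hTS hk) j hj hkj
    have hleft : y j - I.r j ≤ I.swap y i j a - I.r a := by
      rcases hai with rfl | rfl
      · rw [swap_apply_left hij]; linarith
      · rw [swap_apply_right]; linarith
    have hright : I.swap y i j a + I.r a ≤ y i + I.r i := by
      rcases hai with rfl | rfl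
      · rw [swap_apply_left hij]; linarith
      · rw [swap_apply_right]; linarith
    have hkk : I.swap y i j k = y k := swap_apply_of_ne hki hkj
    rcases le_or_gt (y k) (y j) with hkj' | hkj'
    · left
      rw [abs_of_nonpos (by linarith : y k - y j ≤ 0)] at hdj
      have hd1 := abs_lt.1 hdj
      refine ⟨by linarith [abs_nonneg (I.r k - I.r j)], ?_⟩
      by_contra hc
      rw [abs_of_nonneg (show 0 ≤ I.swap y i j k - I.swap y i j a by linarith), abs_lt] at hdT
      linarith
    rcases le_or_gt (y i) (y k) with hki' | hki'
    · right
      rw [abs_of_nonneg (by linarith : 0 ≤ y k - y i)] at hdi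
      have hd1 := abs_lt.1 hdi
      refine ⟨by linarith [abs_nonneg (I.r k - I.r i)], ?_⟩
      by_contra hc
      rw [abs_of_nonpos (show I.swap y i j k - I.swap y i j a ≤ 0 by linarith), abs_lt] at hdT
      linarith
    -- a sensor between `i` and `j` would be covered by their union
    · exfalso
      rw [abs_of_pos (by linarith : 0 < y k - y j), abs_lt] at hdj
      rw [abs_of_neg (by linarith : y k - y i < 0), abs_lt] at hdi
      obtain ⟨p, -, -, hp1, hp2, hp⟩ := hS.exists_private_point (hTS hk)
      rcases le_total p (y j + I.r j) with hpj | hpj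
      · exact hkj (hp j hj (by linarith) hpj).symm
      · exact hki (hp i hi (by linarith) (by linarith)).symm
  rintro ⟨k, l⟩ hmem
  obtain ⟨⟨hk, hl⟩, hkl, hlk⟩ := mem_inversions.1 hmem
  dsimp only at hk hl hkl hlk
  have hne : (k, l) ≠ (i, j) := by
    rintro h
    obtain ⟨rfl, rfl⟩ := Prod.mk.inj h
    exact lt_asymm hlk hswap
  refine Finset.mem_erase.2 ⟨hne, mem_inversions.2 ⟨⟨hTS hk, hTS hl⟩, hkl, ?_⟩⟩
  dsimp only
  by_cases hkij : k = i ∨ k = j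
  · by_cases hlij : l = i ∨ l = j
    · rcases hkij with rfl | rfl <;> rcases hlij with rfl | rfl
      · exact absurd hkl (lt_irrefl _)
      · exact absurd rfl hne
      · exact absurd hkl (lt_asymm hidx)
      · exact absurd hkl (lt_irrefl _)
    · rw [not_or] at hlij
      rcases hside l hl hlij.1 hlij.2 k hk hkij with h | h
      · rcases hkij with rfl | rfl <;> linarith
      · exact absurd h.2 (lt_asymm hlk)
  · rw [not_or] at hkij
    by_cases hlij : l = i ∨ l = j
    · rcases hside k hk hkij.1 hkij.2 l hl hlij with h | h
      · exact absurd h.2 (lt_asymm hlk)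
      · rcases hlij with rfl | rfl <;> linarith
    · rw [not_or] at hlij
      rwa [swap_apply_of_ne hkij.1 hkij.2, swap_apply_of_ne hlij.1 hlij.2] at hlk

/-- Exchanging the two centres would not increase the cost; shifting both by the difference of the
radii adds at most twice that difference. -/
theorem cost_swap_le (hij : i < j) (hlt : y j < y i) :
    I.cost (I.swap y i j) ≤ I.cost y + 2 * |I.r i - I.r j| := by
  have hx := I.x_mono hij.le
  have h1 : I.cost (I.swap y i j) - I.cost y =
      (|I.swap y i j i - I.x i| - |y i - I.x i|) + (|I.swap y i j j - I.x j| - |y j - I.x j|) := by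
    rw [cost, cost, ← Finset.sum_sub_distrib]
    refine Finset.sum_eq_add i j hij.ne (fun k _ hk => ?_) (by simp) (by simp)
    rw [swap_apply_of_ne hk.1 hk.2, sub_self]
  rw [swap_apply_left hij.ne, swap_apply_right] at h1
  have h2 : |y j - I.x i| + |y i - I.x j| ≤ |y i - I.x i| + |y j - I.x j| := by
    rcases abs_cases (y j - I.x i) with ⟨h, _⟩ | ⟨h, _⟩ <;>
    rcases abs_cases (y i - I.x j) with ⟨h', _⟩ | ⟨h', _⟩ <;>
    rw [h, h'] <;>
    linarith [le_abs_self (y i - I.x i), neg_abs_le (y i - I.x i), le_abs_self (y j - I.x j),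
      neg_abs_le (y j - I.x j)]
  have h3 : |y j - I.r j + I.r i - I.x i| ≤ |y j - I.x i| + |I.r i - I.r j| := by
    rw [show y j - I.r j + I.r i - I.x i = (y j - I.x i) + (I.r i - I.r j) by ring]
    exact abs_add_le _ _
  have h4 : |y i + I.r i - I.r j - I.x j| ≤ |y i - I.x j| + |I.r i - I.r j| := by
    rw [show y i + I.r i - I.r j - I.x j = (y i - I.x j) + (I.r i - I.r j) by ring]
    exact abs_add_le _ _
  linarith

/-! ### The untangling process -/

/-- As long as an overlapping pair is in the wrong order, a step is possible that decreases the
number of inversions and does not increase the cost plus twice the sum of the radius differences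
over the inversions. -/
theorem IsMinimalActive.exists_untangleStep (hS : I.IsMinimalActive S y) (hi : i ∈ S) (hj : j ∈ S)
    (hij : i < j) (hlt : y j < y i) (hov : I.Overlap y i j) :
    ∃ T z, I.UntangleStep (S, y) (T, z) ∧ I.IsMinimalActive T z ∧
      (inversions T z).card < (inversions S y).card ∧
      I.cost z + ∑ q ∈ inversions T z, 2 * |I.r q.1 - I.r q.2| ≤
        I.cost y + ∑ q ∈ inversions S y, 2 * |I.r q.1 - I.r q.2| := by
  obtain ⟨T, hTS, hT⟩ := (hS.isActive_swap hi hj hlt hov).exists_isMinimalActive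
  set z : Fin n → ℝ := fun k => if k ∈ T then I.swap y i j k else I.x k with hz
  have hzT : ∀ k ∈ T, I.swap y i j k = z k := fun k hk => by simp [hz, hk]
  have hinv : inversions T z = inversions T (I.swap y i j) := by
    ext q
    simp only [mem_inversions]
    refine and_congr_right fun h => ?_
    rw [hzT _ h.1, hzT _ h.2]
  have hsub := inversions_swap_subset hS hi hj hij hlt hov hTS hT
  have hmem : (i, j) ∈ inversions S y := mem_inversions.2 ⟨⟨hi, hj⟩, hij, hlt⟩
  refine ⟨T, z, ⟨i, hi, j, hj, hij, hlt, hov, hTS, hT, rfl⟩, hT.congr hzT, ?_, ?_⟩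
  · rw [hinv]
    exact (Finset.card_le_card hsub).trans_lt (Finset.card_erase_lt_of_mem hmem)
  · have h1 : I.cost z ≤ I.cost (I.swap y i j) := by
      refine Finset.sum_le_sum fun k _ => ?_
      by_cases hk : k ∈ T
      · rw [hzT k hk]
      · simp [hz, hk]
    have h2 := I.cost_swap_le hij hlt
    have h3 : ∑ q ∈ inversions T z, 2 * |I.r q.1 - I.r q.2| ≤
        ∑ q ∈ (inversions S y).erase (i, j), 2 * |I.r q.1 - I.r q.2| := by
      rw [hinv]
      exact Finset.sum_le_sum_of_subset_of_nonneg hsub fun _ _ _ => by positivity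
    have h4 := Finset.add_sum_erase (inversions S y) (fun q => 2 * |I.r q.1 - I.r q.2|) hmem
    dsimp only at h4
    linarith

theorem IsMinimalActive.exists_isUntangling (hS : I.IsMinimalActive S y) :
    ∃ z, I.IsUntangling S y z ∧ I.IsOrderPreserving z ∧
      I.cost z ≤ I.cost y + ∑ q ∈ inversions S y, 2 * |I.r q.1 - I.r q.2| := by
  induction hN : (inversions S y).card using Nat.strong_induction_on generalizing S y with
  | _ N ih =>
    by_cases hdone : ∀ i ∈ S, ∀ j ∈ S, i < j → I.Overlap y i j → y i < y j
    · exact ⟨y, ⟨S, Relation.ReflTransGen.refl, hdone⟩,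
        ⟨S, hS.1, hS.lt_of_overlap_ordered hdone⟩,
        le_add_of_nonneg_right (Finset.sum_nonneg fun _ _ => by positivity)⟩
    · push Not at hdone
      obtain ⟨i, hi, j, hj, hij, hov, hle⟩ := hdone
      have hlt : y j < y i := by
        refine lt_of_le_of_ne hle fun he => ?_
        have := hS.thinFamily.abs_sub_lt i hi j hj hij.ne
        rw [he, sub_self, abs_zero] at this
        exact absurd this (not_lt.2 (abs_nonneg _))
      obtain ⟨T, w, hstep, hT, hcard, hcost⟩ := hS.exists_untangleStep hi hj hij hlt hov
      obtain ⟨z, ⟨U, hU, hUov⟩, hz, hzc⟩ := ih _ (hN ▸ hcard) hT rfl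
      exact ⟨z, ⟨U, Relation.ReflTransGen.head hstep hU, hUov⟩, hz, hzc.trans hcost⟩

/-! ### The approximation guarantee -/

/-- In an optimal solution, the sensors outside an active set have not moved. -/
theorem IsOptimal.cost_eq_sum (hy : I.IsOptimal y) (hS : I.IsActive S y) :
    I.cost y = ∑ i ∈ S, |y i - I.x i| := by
  refine le_antisymm ?_ (Finset.sum_le_sum_of_subset_of_nonneg (Finset.subset_univ S)
    fun _ _ _ => abs_nonneg _)
  have h1 : I.IsFeasible fun k => if k ∈ S then y k else I.x k :=
    (hS.congr fun k hk => by simp [hk]).mono (Finset.subset_univ S)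
  refine (hy.2 _ h1).trans (le_of_eq ?_)
  rw [cost, ← Finset.sum_subset (Finset.subset_univ S)]
  · exact Finset.sum_congr rfl fun k hk => by simp [hk]
  · intro k _ hk
    simp [hk]

theorem iInf_r_pos [Nonempty (Fin n)] : 0 < ⨅ i, I.r i := by
  obtain ⟨k, hk⟩ := exists_eq_ciInf_of_finite (f := I.r)
  rw [← hk]
  exact I.r_pos k

theorem one_le_rho [Nonempty (Fin n)] : 1 ≤ I.rho :=
  let i := Classical.arbitrary (Fin n)
  (one_le_div I.iInf_r_pos).2 ((ciInf_le (Set.finite_range I.r).bddBelow i).trans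
    (le_ciSup (Set.finite_range I.r).bddAbove i))

theorem three_le_two_div_add {ρ ε : ℝ} (hρ : 1 ≤ ρ) (hε : 0 < ε) :
    3 ≤ 2 / ρ + ε * ρ + 2 / ε := by
  have hρ0 : 0 < ρ := by linarith
  have h : 2 / ρ + ε * ρ + 2 / ε - 3 = ((ε * ρ) ^ 2 - 3 * (ε * ρ) + 2 * ρ + 2 * ε) / (ρ * ε) := by
    field_simp
    ring
  have h2 : 0 ≤ (ε * ρ) ^ 2 - 3 * (ε * ρ) + 2 * ρ + 2 * ε := by
    nlinarith [sq_nonneg (ε * ρ - 3 / 2), sq_nonneg (ρ - ε), sq_nonneg (ε * ρ - 1)]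
  have h3 := div_nonneg h2 (mul_pos hρ0 hε).le
  linarith

/-- Some untangling of an optimal solution costs at most `3 + 2 ρ - 2 / ρ` times as much, and this
is at most `(2 + ε) ρ + 2 / ε` for every `ε > 0`. -/
theorem IsOptimal.exists_untangling_cost_le (hy : I.IsOptimal y) (hS : I.IsMinimalActive S y)
    {ε : ℝ} (hε : 0 < ε) :
    ∃ z, I.IsUntangling S y z ∧ I.IsOrderPreserving z ∧
      I.cost z ≤ ((2 + ε) * I.rho + 2 / ε) * ∑ i ∈ S, |y i - I.x i| := by
  obtain ⟨z, hz, hzo, hzc⟩ := hS.exists_isUntangling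
  refine ⟨z, hz, hzo, hzc.trans ?_⟩
  obtain ⟨i, -⟩ := isActive_iff.1 hS.1 0 le_rfl I.L_nonneg
  have : Nonempty (Fin n) := ⟨i⟩
  have h1 := sum_inversions_le I.x_mono hS.thinFamily (M := ⨆ i, I.r i) I.iInf_r_pos fun i =>
    ⟨ciInf_le (Set.finite_range I.r).bddBelow i, le_ciSup (Set.finite_range I.r).bddAbove i⟩
  have e1 : (⨅ i, I.r i) / (⨆ i, I.r i) = 1 / I.rho := by rw [rho, one_div_div]
  have e2 : (⨆ i, I.r i) / (⨅ i, I.r i) = I.rho := rfl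
  rw [e1, e2] at h1
  rw [hy.cost_eq_sum hS.1]
  have h2 := three_le_two_div_add I.one_le_rho hε
  have h3 : 1 + (2 + 2 * (I.rho - 1 / I.rho)) ≤ (2 + ε) * I.rho + 2 / ε := by
    have : 2 / I.rho = 2 * (1 / I.rho) := by ring
    linarith
  have h4 := mul_le_mul_of_nonneg_right h3
    (Finset.sum_nonneg fun i (_ : i ∈ S) => abs_nonneg (y i - I.x i))
  linarith

theorem IsOrderPreserving.isFeasible (h : I.IsOrderPreserving y) : I.IsFeasible y := by
  obtain ⟨S, hS, -⟩ := h
  exact hS.mono (Finset.subset_univ S)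

end MinimalActive

end BarrierInstance

theorem mainTheorem3 {n : ℕ} (I : BarrierInstance n) (y : Fin n → ℝ) (hy : I.IsOptimal y)
    (S : Finset (Fin n)) (hS : I.IsMinimalActive S y) (ε : ℝ) (hε : 0 < ε) :
    (∃ y' : Fin n → ℝ, I.IsUntangling S y y' ∧ I.IsOrderPreserving y' ∧
      (∃ ξ : S → ℝ, I.IsBalancedScheme ((2 + ε) * I.rho + 2 / ε) S y y' ξ) ∧
      I.IsApprox ((2 + ε) * I.rho + 2 / ε) y') ∧
    (∀ (δ : ℝ) (z : Fin n → ℝ), 0 ≤ δ → I.IsApproxOrderPreserving (1 + δ) z →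
      I.IsApprox ((1 + δ) * ((2 + ε) * I.rho + 2 / ε)) z) := by
  obtain ⟨y', hun, hop, hcost⟩ := hy.exists_untangling_cost_le hS hε
  obtain ⟨i, -⟩ := BarrierInstance.isActive_iff.1 hS.1 0 le_rfl I.L_nonneg
  have hβ : 0 ≤ (2 + ε) * I.rho + 2 / ε := by
    have : Nonempty (Fin n) := ⟨i⟩
    have := I.one_le_rho
    positivity
  have happ : I.IsApprox ((2 + ε) * I.rho + 2 / ε) y' := by
    refine ⟨hop.isFeasible, fun z hz => hcost.trans ?_⟩
    rw [← hy.cost_eq_sum hS.1]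
    exact mul_le_mul_of_nonneg_left (hy.2 z hz) hβ
  refine ⟨⟨y', hun, hop, ⟨fun i => ((2 + ε) * I.rho + 2 / ε) * |I.x i - y i|,
    fun i => mul_nonneg hβ (abs_nonneg _), ?_, fun i => le_rfl⟩, happ⟩, ?_⟩
  · rw [← Finset.mul_sum, Finset.sum_coe_sort S fun i => |I.x i - y i|]
    simpa only [abs_sub_comm] using hcost
  · intro δ z hδ hz
    refine ⟨hz.1.isFeasible, fun w hw => (hz.2 y' hop).trans ?_⟩
    rw [mul_assoc]
    exact mul_le_mul_of_nonneg_left (happ.2 w hw) (by linarith)
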